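/- **Setting.** For two formal series $f_j(z)=\sum_{k\ge 0}s_{j,k}z^{-k-1}$, $j=1,2$, with complex coefficients and $n,m\ge 0$, a (type II) Hermite–Padé denominator of index $(n,m)$ is a polynomial $P$ with $\deg P\le n+m$ for which there are polynomials $Q^{(1)},Q^{(2)}$ with $f_1P-Q^{(1)}=O(z^{-n-1})$ and $f_2P-Q^{(2)}=O(z^{-m-1})$ as $z\to\infty$. The index $(n,m)$ is normal if the nonzero denominator is unique up to a constant factor and every nonzero denominator has degree exactly $n+m$; then $P_{n,m}$ denotes the monic one. The pair $(f_1,f_2)$ is perfect if all indices $(n,m)$, $n,m\ge0$, are normal. For complex arrays $\alpha^{(1)},\dots,\alpha^{(5)},\beta^{(1)}$ indexed by $n,m\ge 0$ put $$L_{n,m}(x)=\begin{pmatrix}x+\alpha^{(1)}_{n,m}&\alpha^{(2)}_{n,m}&\alpha^{(3)}_{n,m}\\ \alpha^{(4)}_{n+1,m}&0&0\\ \alpha^{(5)}_{n+1,m}&0&1\end{pmatrix},\qquad M_{n,m}(x)=\begin{pmatrix}x+\beta^{(1)}_{n,m}&\alpha^{(2)}_{n,m}&\alpha^{(3)}_{n,m}\\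 \alpha^{(4)}_{n,m+1}&1&0\\ \alpha^{(5)}_{n,m+1}&0&0\end{pmatrix}.$$ This family has coefficients $(a,b,c,d)$ if, for all $n,m\ge 0$, $c_{n,m}=-\alpha^{(1)}_{n,m}$, $d_{n,m}=-\beta^{(1)}_{n,m}$, $a_{n,m}=-\alpha^{(4)}_{n,m}\alpha^{(2)}_{n,m}$, $b_{n,m}=-\alpha^{(5)}_{n,m}\alpha^{(3)}_{n,m}$. It has zero curvature if $L_{n,m+1}(x)M_{n,m}(x)-M_{n+1,m}(x)L_{n,m}(x)=0$ for all $n,m\ge 0$ and $x\in\mathbb C$. Consider the system of difference equations $$\begin{cases}c_{n,m+1}=c_{n,m}+\dfrac{(a+b)_{n+1,m}-(a+b)_{n,m+1}}{(c-d)_{n,m}}, & n,m\ge 0,\\[2mm] d_{n+1,m}=d_{n,m}+\dfrac{(a+b)_{n+1,m}-(a+b)_{n,m+1}}{(c-d)_{n,m}}, & n,m\ge 0,\\[2mm] a_{n,m+1}=a_{n,m}\dfrac{(c-d)_{n,m}}{(c-d)_{n-1,m}}, & n\ge 1,\ m\ge 0,\\[2mm] b_{n+1,m}=b_{n,m}\dfrac{(c-d)_{n,m}}{(c-d)_{n,m-1}},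 & n\ge 0,\ m\ge 1.\end{cases}\qquad(\ast)$$ A solution is a quadruple $(a,b,c,d)$ of complex arrays on $\{n,m\ge0\}$ with $a_{0,m}=0=b_{n,0}$ and $(c-d)_{n,m}\ne0$ for all $n,m\ge0$ that satisfies $(\ast)$. It is nondegenerate if $a_{n,m}\neq0$ and $b_{n,m}\ne 0$ for all $n,m>0$. **Theorem.** (1) Let $a,b,c,d$ be complex arrays on $\{n,m\ge 0\}$ with $a_{0,m}=0=b_{n,0}$ for all $n,m\ge 0$. (1a) If $(c-d)_{n,m}\neq 0$ for all $n,m\ge 0$, then $(a,b,c,d)$ satisfies $(\ast)$ if and only if some family of matrices $L_{n,m},M_{n,m}$ of the above form with coefficients $(a,b,c,d)$ has zero curvature. (1b) The following are equivalent: (i) some family of matrices $L_{n,m},M_{n,m}$ of the above form, all invertible for every $x\in\mathbb C$, with coefficients $(a,b,c,d)$, has zero curvature; (ii) $(a,b,c,d)$ is a nondegenerate solution; (iii) there is a perfect pair $(f_1,f_2)$ whose monic Hermite–Padé polynomials satisfy, for all $n,m\ge 0$, $$\begin{aligned}P_{n+1,m}(x)&=(x-c_{n,m})P_{n,m}(x)-a_{n,m}P_{n-1,m}(x)-b_{n,m}P_{n,m-1}(x),\\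 P_{n,m+1}(x)&=(x-d_{n,m})P_{n,m}(x)-a_{n,m}P_{n-1,m}(x)-b_{n,m}P_{n,m-1}(x),\end{aligned}$$ where $P_{-1,m}=P_{n,-1}=0$. (2) Let complex initial data $\hat c_n$, $\hat a_{n+1}$, $\hat d_m$, $\hat b_{m+1}$ ($n,m\ge 0$) be given. There is a nondegenerate solution with $c_{n,0}=\hat c_n$, $a_{n+1,0}=\hat a_{n+1}$, $d_{0,m}=\hat d_m$, $b_{0,m+1}=\hat b_{m+1}$ for all $n,m\ge0$ if and only if the data correspond to a perfect system, that is, there is a perfect pair $(f_1,f_2)$ whose marginal monic Hermite–Padé polynomials satisfy $P_{1,0}=x-\hat c_0$, $P_{0,1}=x-\hat d_0$ and, for all $n,m\ge 0$, $$P_{n+2,0}=(x-\hat c_{n+1})P_{n+1,0}-\hat a_{n+1}P_{n,0},\qquad P_{0,m+2}=(x-\hat d_{m+1})P_{0,m+1}-\hat b_{m+1}P_{0,m}.$$ -/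

import Mathlib

open Polynomial

namespace HPLax

/-- The polynomial `p`, read as a Laurent series at infinity. Series at infinity are elements of
`LaurentSeries ℂ` in the local parameter `u = 1/z`, so `z` is `u ^ (-1)`. -/
noncomputable def polyAtInfty (p : ℂ[X]) : LaurentSeries ℂ :=
  Polynomial.aeval (HahnSeries.single (-1 : ℤ) (1 : ℂ)) p

/-- The formal series `f(z) = ∑_{k ≥ 0} s_k / z ^ (k + 1)`. -/
noncomputable def momentSeries (s : ℕ → ℂ) : LaurentSeries ℂ :=
  HahnSeries.ofPowerSeries ℤ ℂ (PowerSeries.X * PowerSeries.mk s)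

/-- `R = O(1 / z ^ N)` as `z → ∞`, for a Laurent series at infinity. -/
def IsBigOInfty (R : LaurentSeries ℂ) (N : ℕ) : Prop :=
  ∀ k : ℤ, k < N → R.coeff k = 0

/-- `P` is a (possibly zero, not necessarily normalized) denominator of the type II Hermite-Padé
approximant with multi-index `(n, m)` of the pair of series with coefficients `s₁`, `s₂`. -/
def IsHermitePade (s₁ s₂ : ℕ → ℂ) (n m : ℕ) (P : ℂ[X]) : Prop :=
  P.natDegree ≤ n + m ∧
  (∃ Q₁ : ℂ[X],
    IsBigOInfty (momentSeries s₁ * polyAtInfty P - polyAtInfty Q₁) (n + 1)) ∧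
  (∃ Q₂ : ℂ[X],
    IsBigOInfty (momentSeries s₂ * polyAtInfty P - polyAtInfty Q₂) (m + 1))

/-- The multi-index `(n, m)` is normal: the nontrivial Hermite-Padé denominator is unique up to a
multiplicative constant and every nontrivial one has full degree `n + m`. -/
def IsNormalIndex (s₁ s₂ : ℕ → ℂ) (n m : ℕ) : Prop :=
  (∀ P P' : ℂ[X], IsHermitePade s₁ s₂ n m P → IsHermitePade s₁ s₂ n m P' → P ≠ 0 →
    ∃ t : ℂ, P' = C t * P) ∧
  (∀ P : ℂ[X], IsHermitePade s₁ s₂ n m P → P ≠ 0 → P.natDegree = n + m)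

/-- A perfect system: all multi-indices are normal. -/
def IsPerfect (s₁ s₂ : ℕ → ℂ) : Prop :=
  ∀ n m : ℕ, IsNormalIndex s₁ s₂ n m

/-- `P n m` is the table of the monic Hermite-Padé polynomials. -/
def IsHermitePadeTable (s₁ s₂ : ℕ → ℂ) (P : ℕ → ℕ → ℂ[X]) : Prop :=
  ∀ n m : ℕ, (P n m).Monic ∧ IsHermitePade s₁ s₂ n m (P n m)

/-- `P_{n-1,m}`, with `P_{-1,m} = 0`. -/
noncomputable def prevFst (P : ℕ → ℕ → ℂ[X]) : ℕ → ℕ → ℂ[X]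
  | 0, _ => 0
  | n + 1, m => P n m

/-- `P_{n,m-1}`, with `P_{n,-1} = 0`. -/
noncomputable def prevSnd (P : ℕ → ℕ → ℂ[X]) : ℕ → ℕ → ℂ[X]
  | _, 0 => 0
  | n, m + 1 => P n m

/-- The nearest neighbour recurrence relations with coefficients `a, b, c, d`. -/
def NearestNeighbour (P : ℕ → ℕ → ℂ[X]) (a b c d : ℕ → ℕ → ℂ) : Prop :=
  (∀ n m : ℕ, P (n + 1) m =
    (X - C (c n m)) * P n m - C (a n m) * prevFst P n m - C (b n m) * prevSnd P n m) ∧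
  (∀ n m : ℕ, P n (m + 1) =
    (X - C (d n m)) * P n m - C (a n m) * prevFst P n m - C (b n m) * prevSnd P n m)

/-- The entries of the transition matrices. -/
structure LaxEntries where
  α₁ : ℕ → ℕ → ℂ
  β₁ : ℕ → ℕ → ℂ
  α₂ : ℕ → ℕ → ℂ
  α₃ : ℕ → ℕ → ℂ
  α₄ : ℕ → ℕ → ℂ
  α₅ : ℕ → ℕ → ℂ

/-- The transition matrix `L_{n,m}` at the point `x`. -/
def LaxEntries.L (e : LaxEntries) (n m : ℕ) (x : ℂ) : Matrix (Fin 3) (Fin 3) ℂ :=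
  !![x + e.α₁ n m, e.α₂ n m, e.α₃ n m;
     e.α₄ (n + 1) m, 0, 0;
     e.α₅ (n + 1) m, 0, 1]

/-- The transition matrix `M_{n,m}` at the point `x`. -/
def LaxEntries.M (e : LaxEntries) (n m : ℕ) (x : ℂ) : Matrix (Fin 3) (Fin 3) ℂ :=
  !![x + e.β₁ n m, e.α₂ n m, e.α₃ n m;
     e.α₄ n (m + 1), 1, 0;
     e.α₅ n (m + 1), 0, 0]

/-- The discrete zero curvature condition. -/
def LaxEntries.ZeroCurvature (e : LaxEntries) : Prop :=
  ∀ (n m : ℕ) (x : ℂ), e.L n (m + 1) x * e.M n m x - e.M (n + 1) m x * e.L n m x = 0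

/-- All transition matrices are invertible. -/
def LaxEntries.Invertible (e : LaxEntries) : Prop :=
  ∀ (n m : ℕ) (x : ℂ), IsUnit (e.L n m x) ∧ IsUnit (e.M n m x)

/-- The relation between the entries of the matrices and the recurrence coefficients. -/
def LaxEntries.HasCoefficients (e : LaxEntries) (a b c d : ℕ → ℕ → ℂ) : Prop :=
  ∀ n m : ℕ, c n m = -e.α₁ n m ∧ d n m = -e.β₁ n m ∧
    a n m = -(e.α₄ n m * e.α₂ n m) ∧ b n m = -(e.α₅ n m * e.α₃ n m)

/-- The boundary conditions `a_{0,m} = 0 = b_{n,0}`. -/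
def ZeroBoundary (a b : ℕ → ℕ → ℂ) : Prop :=
  (∀ m : ℕ, a 0 m = 0) ∧ (∀ n : ℕ, b n 0 = 0)

/-- All denominators `(c - d)_{n,m}` are nonzero. -/
def NonzeroDenominators (c d : ℕ → ℕ → ℂ) : Prop :=
  ∀ n m : ℕ, c n m - d n m ≠ 0

/-- The nonlinear system of difference equations. In the third (fourth) equation the index `n`
(`m`) is at least one and is written `n + 1` (`m + 1`); on the boundary `n = 0` (`m = 0`) it is
replaced by the condition `a_{0,m} = 0` (`b_{n,0} = 0`). -/
structure DifferenceSystem (a b c d : ℕ → ℕ → ℂ) : Prop where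
  eq_c : ∀ n m : ℕ, c n (m + 1) = c n m +
    ((a (n + 1) m + b (n + 1) m) - (a n (m + 1) + b n (m + 1))) / (c n m - d n m)
  eq_d : ∀ n m : ℕ, d (n + 1) m = d n m +
    ((a (n + 1) m + b (n + 1) m) - (a n (m + 1) + b n (m + 1))) / (c n m - d n m)
  eq_a : ∀ n m : ℕ, a (n + 1) (m + 1) =
    a (n + 1) m * ((c (n + 1) m - d (n + 1) m) / (c n m - d n m))
  eq_b : ∀ n m : ℕ, b (n + 1) (m + 1) =
    b n (m + 1) * ((c n (m + 1) - d n (m + 1)) / (c n m - d n m))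

/-- A solution: the boundary conditions hold, the system makes sense, and it holds. -/
def IsSolution (a b c d : ℕ → ℕ → ℂ) : Prop :=
  ZeroBoundary a b ∧ NonzeroDenominators c d ∧ DifferenceSystem a b c d

/-- `a_{n,m} ≠ 0` and `b_{n,m} ≠ 0` for `n, m > 0`. -/
def NonvanishingInside (a b : ℕ → ℕ → ℂ) : Prop :=
  ∀ n m : ℕ, 0 < n → 0 < m → a n m ≠ 0 ∧ b n m ≠ 0

/-- The initial data are `c_{n,0} = c₀ n`, `a_{n,0} = a₀ n` for `n ≥ 1`, `d_{0,m} = d₀ m`,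
`b_{0,m} = b₀ m` for `m ≥ 1`; the values `a₀ 0` and `b₀ 0` play no role. -/
def HasInitialData (a b c d : ℕ → ℕ → ℂ) (c₀ a₀ d₀ b₀ : ℕ → ℂ) : Prop :=
  (∀ n : ℕ, c n 0 = c₀ n) ∧ (∀ n : ℕ, a (n + 1) 0 = a₀ (n + 1)) ∧
  (∀ m : ℕ, d 0 m = d₀ m) ∧ (∀ m : ℕ, b 0 (m + 1) = b₀ (m + 1))

/-- The initial data correspond to the pair of series with coefficients `s₁`, `s₂`: they are the
coefficients of the three-term recurrence relations of the marginal Hermite-Padé polynomials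
`P_{n,0}` and `P_{0,m}`. -/
def DataCorrespond (s₁ s₂ : ℕ → ℂ) (c₀ a₀ d₀ b₀ : ℕ → ℂ) : Prop :=
  ∃ P : ℕ → ℕ → ℂ[X], IsHermitePadeTable s₁ s₂ P ∧
    P 1 0 = (X - C (c₀ 0)) * P 0 0 ∧
    (∀ n : ℕ, P (n + 2) 0 = (X - C (c₀ (n + 1))) * P (n + 1) 0 - C (a₀ (n + 1)) * P n 0) ∧
    P 0 1 = (X - C (d₀ 0)) * P 0 0 ∧
    (∀ m : ℕ, P 0 (m + 2) = (X - C (d₀ (m + 1))) * P 0 (m + 1) - C (b₀ (m + 1)) * P 0 m)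

end HPLax

/-! Expanding at infinity turns the approximation conditions into orthogonality: `P` is orthogonal
to `X ^ k` for `k < n` under the moments `s₁` and for `k < m` under `s₂` (`isHermitePade_iff`). The
central quantity is h(n,m) = `moment s₁ (X ^ n * P n m)`, which never vanishes for a perfect pair.

From perfect pairs to solutions: the recurrences give h(n+1,m) = a(n+1,m) h(n,m) and h(n,m+1) =
(c-d)(n,m) h(n,m), so a and c-d do not vanish where required, and the two ways round a unit square
give the equation for a. Exchanging the two series gives the one for b. The equations for c and d
come from reaching P(n+1,m+1) in two ways and comparing its second and third highest coefficients
(`coeff_compatibility`).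

From solutions to perfect pairs: the difference system makes the two recurrences compatible, so they
generate a table of polynomials (`IsSolution.nearestNeighbour`). Favard's theorem on the bottom row
and on the left column supplies the two functionals, orthogonality spreads through the table
(`exists_orth_fst`), and nonvanishing of the moments forces normality (`isPerfect_of_table`).

On the matrix side, zero curvature read entrywise is this compatibility together with multiplicative
relations for `α₂`, …, `α₅`. Their products are the equations for a and b; conversely they can be
solved by telescoping products. Part (2) follows because the marginal polynomials determine the
initial data. -/

namespace HPLax

/-! ### Moment functionals and orthogonality. -/

section Moment

/-- The linear functional on polynomials with moments `s`. -/
noncomputable def moment (s : ℕ → ℂ) : ℂ[X] →ₗ[ℂ] ℂ :=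
  (Polynomial.basisMonomials ℂ).constr ℂ s

theorem moment_monomial (s : ℕ → ℂ) (n : ℕ) (r : ℂ) : moment s (monomial n r) = r * s n := by
  have h : (monomial n r : ℂ[X]) = r • Polynomial.basisMonomials ℂ n := by
    simp [smul_monomial]
  rw [h, map_smul, moment, Module.Basis.constr_basis, smul_eq_mul]

theorem moment_C_mul (s : ℕ → ℂ) (r : ℂ) (p : ℂ[X]) : moment s (C r * p) = r * moment s p := by
  rw [← smul_eq_C_mul, map_smul, smul_eq_mul]

theorem exists_moment_eq (φ : ℂ[X] →ₗ[ℂ] ℂ) : ∃ s : ℕ → ℂ, moment s = φ := by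
  refine ⟨fun n => φ (Polynomial.basisMonomials ℂ n), ?_⟩
  exact (Polynomial.basisMonomials ℂ).constr_self ℂ φ

/-- `p` is orthogonal to `1, X, …, X ^ (n - 1)` with respect to the functional with moments `s`. -/
def Orth (s : ℕ → ℂ) (n : ℕ) (p : ℂ[X]) : Prop :=
  ∀ k < n, moment s (X ^ k * p) = 0

theorem Orth.mono {s : ℕ → ℂ} {m n : ℕ} {p : ℂ[X]} (h : Orth s n p) (hmn : m ≤ n) : Orth s m p :=
  fun k hk => h k (by omega)

theorem Orth.sub {s : ℕ → ℂ} {n : ℕ} {p q : ℂ[X]} (hp : Orth s n p) (hq : Orth s n q) :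
    Orth s n (p - q) := fun k hk => by
  rw [mul_sub, map_sub, hp k hk, hq k hk, sub_zero]

theorem Orth.add {s : ℕ → ℂ} {n : ℕ} {p q : ℂ[X]} (hp : Orth s n p) (hq : Orth s n q) :
    Orth s n (p + q) := fun k hk => by
  rw [mul_add, map_add, hp k hk, hq k hk, add_zero]

theorem Orth.C_mul {s : ℕ → ℂ} {n : ℕ} {p : ℂ[X]} (hp : Orth s n p) (r : ℂ) :
    Orth s n (C r * p) := fun k hk => by
  rw [mul_left_comm, moment_C_mul, hp k hk, mul_zero]

theorem Orth.succ {s : ℕ → ℂ} {n : ℕ} {p : ℂ[X]} (hp : Orth s n p)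
    (h : moment s (X ^ n * p) = 0) : Orth s (n + 1) p := fun k hk => by
  rcases Nat.lt_succ_iff_lt_or_eq.1 hk with h' | rfl
  · exact hp k h'
  · exact h

theorem Orth.X_mul {s : ℕ → ℂ} {n : ℕ} {p : ℂ[X]} (hp : Orth s (n + 1) p) :
    Orth s n (X * p) := fun k hk => by
  rw [← mul_assoc, ← pow_succ]
  exact hp _ (by omega)

end Moment

/-! ### Hermite–Padé conditions as orthogonality conditions. -/

section Laurent

theorem coeff_momentSeries (s : ℕ → ℂ) (k : ℕ) : (momentSeries s).coeff (k + 1 : ℤ) = s k := by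
  have : (k + 1 : ℤ) = ((k + 1 : ℕ) : ℤ) := by push_cast; rfl
  rw [momentSeries, this, HahnSeries.ofPowerSeries_apply_coeff, PowerSeries.coeff_succ_X_mul,
    PowerSeries.coeff_mk]

theorem coeff_momentSeries_of_nonpos (s : ℕ → ℂ) {k : ℤ} (hk : k ≤ 0) :
    (momentSeries s).coeff k = 0 := by
  rcases hk.lt_or_eq with h | rfl
  · rw [momentSeries, HahnSeries.ofPowerSeries_apply]
    apply HahnSeries.embDomain_of_notMem_range
    rintro ⟨n, hn⟩
    simp at hn
    omega
  · have := HahnSeries.ofPowerSeries_apply_coeff (Γ := ℤ) (PowerSeries.X * PowerSeries.mk s) 0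
    simpa [momentSeries] using this

theorem polyAtInfty_monomial (n : ℕ) (r : ℂ) :
    polyAtInfty (monomial n r) = HahnSeries.single (-(n : ℤ)) r := by
  rw [polyAtInfty, aeval_monomial, HahnSeries.single_pow, HahnSeries.algebraMap_apply',
    one_pow, nsmul_eq_mul, mul_neg_one]
  simp [HahnSeries.C_apply, HahnSeries.single_mul_single]

theorem polyAtInfty_add (p q : ℂ[X]) : polyAtInfty (p + q) = polyAtInfty p + polyAtInfty q :=
  map_add _ _ _

theorem coeff_polyAtInfty_neg (p : ℂ[X]) (n : ℕ) :
    (polyAtInfty p).coeff (-(n : ℤ)) = p.coeff n := by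
  induction p using Polynomial.induction_on' with
  | add p q hp hq => rw [polyAtInfty_add, HahnSeries.coeff_add, hp, hq, coeff_add]
  | monomial j r =>
    rw [polyAtInfty_monomial, HahnSeries.coeff_single, coeff_monomial]
    simp [eq_comm]

theorem coeff_polyAtInfty_of_pos (p : ℂ[X]) {k : ℤ} (hk : 0 < k) : (polyAtInfty p).coeff k = 0 := by
  induction p using Polynomial.induction_on' with
  | add p q hp hq => rw [polyAtInfty_add, HahnSeries.coeff_add, hp, hq, add_zero]
  | monomial j r =>
    rw [polyAtInfty_monomial, HahnSeries.coeff_single_of_ne (by omega)]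

theorem coeff_mul_polyAtInfty_monomial (f : LaurentSeries ℂ) (j : ℕ) (r : ℂ) (k : ℤ) :
    (f * polyAtInfty (monomial j r)).coeff k = f.coeff (k + j) * r := by
  rw [polyAtInfty_monomial]
  have := HahnSeries.coeff_mul_single_add (r := r) (x := f) (a := k + j) (b := -(j : ℤ))
  rwa [add_neg_cancel_right] at this

theorem coeff_momentSeries_mul (s : ℕ → ℂ) (p : ℂ[X]) (k : ℕ) :
    (momentSeries s * polyAtInfty p).coeff (k + 1 : ℤ) = moment s (X ^ k * p) := by
  induction p using Polynomial.induction_on' with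
  | add p q hp hq => rw [polyAtInfty_add, mul_add, HahnSeries.coeff_add, hp, hq, mul_add, map_add]
  | monomial j r =>
    have h : (k + 1 + j : ℤ) = ((k + j : ℕ) : ℤ) + 1 := by push_cast; ring
    rw [coeff_mul_polyAtInfty_monomial, h, coeff_momentSeries, X_pow_mul_monomial, moment_monomial,
      mul_comm, add_comm k j]

theorem exists_coeff_momentSeries_mul (s : ℕ → ℂ) (p : ℂ[X]) : ∃ q : ℂ[X],
    ∀ k : ℕ, (momentSeries s * polyAtInfty p).coeff (-(k : ℤ)) = q.coeff k := by
  induction p using Polynomial.induction_on' with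
  | add p q hp hq =>
    obtain ⟨p', hp⟩ := hp
    obtain ⟨q', hq⟩ := hq
    exact ⟨p' + q', fun k => by
      rw [polyAtInfty_add, mul_add, HahnSeries.coeff_add, hp, hq, coeff_add]⟩
  | monomial j r =>
    refine ⟨∑ i ∈ Finset.range j, monomial i ((momentSeries s).coeff (-(i : ℤ) + j) * r),
      fun k => ?_⟩
    rw [coeff_mul_polyAtInfty_monomial]
    simp only [finsetSum_coeff, coeff_monomial, Finset.sum_ite_eq', Finset.mem_range]
    split_ifs with h
    · rfl
    · rw [coeff_momentSeries_of_nonpos _ (by omega), zero_mul]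

/-- The nonpositive powers of `u` in the product form a polynomial in z, which `q` can always
cancel. What remains is the coefficient of `u ^ (k + 1)`, namely the moment of `X ^ k * p`. -/
theorem exists_isBigOInfty_iff (s : ℕ → ℂ) (p : ℂ[X]) (n : ℕ) :
    (∃ q : ℂ[X], IsBigOInfty (momentSeries s * polyAtInfty p - polyAtInfty q) (n + 1)) ↔
      Orth s n p := by
  constructor
  · rintro ⟨q, hq⟩ k hk
    have := hq (k + 1) (by push_cast; omega)
    rwa [HahnSeries.coeff_sub, coeff_momentSeries_mul, coeff_polyAtInfty_of_pos _ (by omega),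
      sub_zero] at this
  · intro h
    obtain ⟨q, hq⟩ := exists_coeff_momentSeries_mul s p
    refine ⟨q, fun k hk => ?_⟩
    rw [HahnSeries.coeff_sub]
    rcases le_or_gt k 0 with h0 | h0
    · obtain ⟨i, rfl⟩ : ∃ i : ℕ, k = -(i : ℤ) := ⟨(-k).toNat, by omega⟩
      rw [hq, coeff_polyAtInfty_neg, sub_self]
    · obtain ⟨i, rfl⟩ : ∃ i : ℕ, k = (i : ℤ) + 1 := ⟨(k - 1).toNat, by omega⟩
      rw [coeff_momentSeries_mul, coeff_polyAtInfty_of_pos _ h0, sub_zero]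
      exact h i (by push_cast at hk; omega)

theorem isHermitePade_iff {s₁ s₂ : ℕ → ℂ} {n m : ℕ} {P : ℂ[X]} :
    IsHermitePade s₁ s₂ n m P ↔ P.natDegree ≤ n + m ∧ Orth s₁ n P ∧ Orth s₂ m P := by
  rw [IsHermitePade, exists_isBigOInfty_iff, exists_isBigOInfty_iff]

end Laurent

/-! ### Zero curvature and the difference system. -/

section LaxPair

theorem zeroCurvature_iff {e : LaxEntries} {a b c d : ℕ → ℕ → ℂ} (h : e.HasCoefficients a b c d) :
    e.ZeroCurvature ↔ ∀ n m : ℕ,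
      c n (m + 1) + d n m = d (n + 1) m + c n m ∧
      c n (m + 1) * d n m - (a n (m + 1) + b n (m + 1)) =
        d (n + 1) m * c n m - (a (n + 1) m + b (n + 1) m) ∧
      e.α₂ n (m + 1) = (c n m - d n m) * e.α₂ n m ∧
      e.α₃ (n + 1) m = -(c n m - d n m) * e.α₃ n m ∧
      e.α₄ (n + 1) m = (c n m - d n m) * e.α₄ (n + 1) (m + 1) ∧
      e.α₅ n (m + 1) = -(c n m - d n m) * e.α₅ (n + 1) (m + 1) := by
  have entries (n m : ℕ) (x : ℂ) :
      e.L n (m + 1) x * e.M n m x - e.M (n + 1) m x * e.L n m x = 0 ↔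
      ((x - c n (m + 1)) * (x - d n m) - (a n (m + 1) + b n (m + 1)) =
        (x - d (n + 1) m) * (x - c n m) - (a (n + 1) m + b (n + 1) m) ∧
      (x - c n (m + 1)) * e.α₂ n m + e.α₂ n (m + 1) = (x - d (n + 1) m) * e.α₂ n m ∧
      (x - c n (m + 1)) * e.α₃ n m = (x - d (n + 1) m) * e.α₃ n m + e.α₃ (n + 1) m ∧
      e.α₄ (n + 1) m = (c n m - d n m) * e.α₄ (n + 1) (m + 1) ∧
      e.α₅ n (m + 1) = -(c n m - d n m) * e.α₅ (n + 1) (m + 1)) := by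
    obtain ⟨h1, h2, -, -⟩ := h n m
    obtain ⟨h3, -, h5, h6⟩ := h n (m + 1)
    obtain ⟨-, h4, h7, h8⟩ := h (n + 1) m
    rw [h1, h2, h3, h4, h5, h6, h7, h8, ← Matrix.ext_iff]
    simp only [LaxEntries.L, LaxEntries.M, Fin.forall_fin_succ, Matrix.mul_apply,
      Fin.sum_univ_three, Matrix.sub_apply]
    simp
    constructor
    · rintro ⟨⟨e1, e2, e3⟩, e4, e5⟩
      refine ⟨?_, ?_, ?_, ?_, ?_⟩
      · linear_combination e1
      · linear_combination e2
      · linear_combination e3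
      · linear_combination -e4
      · linear_combination e5
    · rintro ⟨e1, e2, e3, e4, e5⟩
      refine ⟨⟨?_, ?_, ?_⟩, ?_, ?_⟩
      · linear_combination e1
      · linear_combination e2
      · linear_combination e3
      · linear_combination -e4
      · linear_combination e5
  simp only [LaxEntries.ZeroCurvature, entries]
  refine forall_congr' fun n => forall_congr' fun m => ⟨fun H => ?_, fun H x => ?_⟩
  -- The terms in x² cancel in the corner entry, so it is affine in x and the values at 0 and 1
  -- determine it.
  · obtain ⟨p0, q0, r0, t, u⟩ := H 0
    obtain ⟨p1, -⟩ := H 1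
    have hs : c n (m + 1) + d n m = d (n + 1) m + c n m := by linear_combination p0 - p1
    refine ⟨hs, by linear_combination p0, ?_, ?_, t, u⟩
    · linear_combination q0 + e.α₂ n m * hs
    · linear_combination -r0 - e.α₃ n m * hs
  · obtain ⟨hs, hp, q, r, t, u⟩ := H
    refine ⟨by linear_combination hp - x * hs, ?_, ?_, t, u⟩
    · linear_combination q - e.α₂ n m * hs
    · linear_combination -r - e.α₃ n m * hs

/-- The system with denominators cleared. The equations for c and d have the same increment, which
is the first relation; the second then expresses the value of this increment. -/
theorem differenceSystem_iff {a b c d : ℕ → ℕ → ℂ} (hcd : NonzeroDenominators c d) :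
    DifferenceSystem a b c d ↔ ∀ n m : ℕ,
      c n (m + 1) + d n m = d (n + 1) m + c n m ∧
      c n (m + 1) * d n m - (a n (m + 1) + b n (m + 1)) =
        d (n + 1) m * c n m - (a (n + 1) m + b (n + 1) m) ∧
      a (n + 1) (m + 1) * (c n m - d n m) = a (n + 1) m * (c (n + 1) m - d (n + 1) m) ∧
      b (n + 1) (m + 1) * (c n m - d n m) = b n (m + 1) * (c n (m + 1) - d n (m + 1)) := by
  constructor
  · intro H n m
    have h0 := hcd n m
    have h1 := H.eq_c n m
    have h2 := H.eq_d n m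
    have h3 := H.eq_a n m
    have h4 := H.eq_b n m
    rw [← mul_div_assoc, eq_div_iff h0] at h3 h4
    have hs : c n (m + 1) - c n m = d (n + 1) m - d n m := by rw [h1, h2]; ring
    have h5 : (c n (m + 1) - c n m) * (c n m - d n m) =
        (a (n + 1) m + b (n + 1) m) - (a n (m + 1) + b n (m + 1)) := by
      rw [h1]; field_simp; ring
    refine ⟨by linear_combination hs, by linear_combination c n m * hs - h5,
      h3, h4⟩
  · intro H
    have key (n m : ℕ) : ((a (n + 1) m + b (n + 1) m) - (a n (m + 1) + b n (m + 1))) /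
        (c n m - d n m) = c n (m + 1) - c n m := by
      obtain ⟨h1, h2, -, -⟩ := H n m
      rw [div_eq_iff (hcd n m)]
      linear_combination h2 - c n m * h1
    refine ⟨fun n m => ?_, fun n m => ?_, fun n m => ?_, fun n m => ?_⟩
    · rw [key]; ring
    · rw [key]; linear_combination -(H n m).1
    · have := (H n m).2.2.1
      rw [← mul_div_assoc, eq_div_iff (hcd n m), this]
    · have := (H n m).2.2.2
      rw [← mul_div_assoc, eq_div_iff (hcd n m), this]

theorem differenceSystem_of_zeroCurvature {e : LaxEntries} {a b c d : ℕ → ℕ → ℂ}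
    (hcd : NonzeroDenominators c d) (h : e.HasCoefficients a b c d) (hz : e.ZeroCurvature) :
    DifferenceSystem a b c d := by
  rw [zeroCurvature_iff h] at hz
  rw [differenceSystem_iff hcd]
  intro n m
  obtain ⟨h1, h2, -, -, h5, h6⟩ := hz n m
  obtain ⟨-, -, h7, -⟩ := hz (n + 1) m
  obtain ⟨-, -, -, h8, -⟩ := hz n (m + 1)
  refine ⟨h1, h2, ?_, ?_⟩
  · rw [(h (n + 1) (m + 1)).2.2.1, (h (n + 1) m).2.2.1, h5, h7]; ring
  · rw [(h (n + 1) (m + 1)).2.2.2, (h n (m + 1)).2.2.2, h6, h8]; ring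

/-- Entries of transition matrices with prescribed recurrence coefficients. -/
noncomputable def laxEntries (a b c d : ℕ → ℕ → ℂ) : LaxEntries where
  α₁ n m := -c n m
  β₁ n m := -d n m
  α₂ n m := ∏ k ∈ Finset.range m, (c n k - d n k)
  α₃ n m := ∏ k ∈ Finset.range n, -(c k m - d k m)
  α₄ n m := -a n m / ∏ k ∈ Finset.range m, (c n k - d n k)
  α₅ n m := -b n m / ∏ k ∈ Finset.range n, -(c k m - d k m)

section

variable {a b c d : ℕ → ℕ → ℂ}

theorem laxEntries_α₂_ne_zero (hcd : NonzeroDenominators c d) (n m : ℕ) :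
    (laxEntries a b c d).α₂ n m ≠ 0 :=
  Finset.prod_ne_zero_iff (s := Finset.range m).2 fun k _ => hcd n k

theorem laxEntries_α₃_ne_zero (hcd : NonzeroDenominators c d) (n m : ℕ) :
    (laxEntries a b c d).α₃ n m ≠ 0 :=
  Finset.prod_ne_zero_iff (s := Finset.range n).2 fun k _ => neg_ne_zero.2 (hcd k m)

theorem hasCoefficients_laxEntries (hcd : NonzeroDenominators c d) :
    (laxEntries a b c d).HasCoefficients a b c d := fun n m => by
  have h2 := laxEntries_α₂_ne_zero (a := a) (b := b) hcd n m
  have h3 := laxEntries_α₃_ne_zero (a := a) (b := b) hcd n m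
  simp only [laxEntries] at h2 h3 ⊢
  refine ⟨by ring, by ring, ?_, ?_⟩
  · rw [div_mul_cancel₀ _ h2, neg_neg]
  · rw [div_mul_cancel₀ _ h3, neg_neg]

/-- The relations for `α₂` and `α₃` hold by telescoping of the products. Those for `α₄` and `α₅`,
defined by division, are then the equations for a and b. -/
theorem zeroCurvature_laxEntries (hcd : NonzeroDenominators c d)
    (h : DifferenceSystem a b c d) : (laxEntries a b c d).ZeroCurvature := by
  rw [zeroCurvature_iff (hasCoefficients_laxEntries hcd)]
  rw [differenceSystem_iff hcd] at h
  intro n m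
  obtain ⟨h1, h2, h3, h4⟩ := h n m
  refine ⟨h1, h2, ?_, ?_, ?_, ?_⟩
  · simp only [laxEntries, Finset.prod_range_succ]; ring
  · simp only [laxEntries, Finset.prod_range_succ]; ring
  · have h5 := laxEntries_α₂_ne_zero (a := a) (b := b) hcd (n + 1) m
    have h6 := hcd (n + 1) m
    simp only [laxEntries, Finset.prod_range_succ] at h5 ⊢
    rw [mul_div_assoc', div_eq_div_iff h5 (mul_ne_zero h5 h6)]
    linear_combination (∏ k ∈ Finset.range m, (c (n + 1) k - d (n + 1) k)) * h3
  · have h5 := laxEntries_α₃_ne_zero (a := a) (b := b) hcd n (m + 1)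
    have h6 := neg_ne_zero.2 (hcd n (m + 1))
    simp only [laxEntries, Finset.prod_range_succ] at h5 ⊢
    rw [mul_div_assoc', div_eq_div_iff h5 (mul_ne_zero h5 h6)]
    linear_combination -(∏ k ∈ Finset.range n, -(c k (m + 1) - d k (m + 1))) * h4

end

/-- The determinants are -`α₂` `α₄` and -`α₃` `α₅`, with the indices of the matrix entries; they do
not depend on x. -/
theorem invertible_iff (e : LaxEntries) :
    e.Invertible ↔ ∀ n m : ℕ, e.α₂ n m ≠ 0 ∧ e.α₃ n m ≠ 0 ∧ e.α₄ (n + 1) m ≠ 0 ∧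
      e.α₅ n (m + 1) ≠ 0 := by
  have hL (n m : ℕ) (x : ℂ) : IsUnit (e.L n m x) ↔ e.α₂ n m ≠ 0 ∧ e.α₄ (n + 1) m ≠ 0 := by
    rw [Matrix.isUnit_iff_isUnit_det, isUnit_iff_ne_zero, LaxEntries.L, Matrix.det_fin_three]
    simp
  have hM (n m : ℕ) (x : ℂ) : IsUnit (e.M n m x) ↔ e.α₃ n m ≠ 0 ∧ e.α₅ n (m + 1) ≠ 0 := by
    rw [Matrix.isUnit_iff_isUnit_det, isUnit_iff_ne_zero, LaxEntries.M, Matrix.det_fin_three]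
    simp
  simp only [LaxEntries.Invertible, hL, hM, forall_const]
  exact forall_congr' fun n => forall_congr' fun m => by tauto

variable {a b c d : ℕ → ℕ → ℂ}

theorem exists_zeroCurvature_iff (hcd : NonzeroDenominators c d) :
    (∃ e : LaxEntries, e.HasCoefficients a b c d ∧ e.ZeroCurvature) ↔ DifferenceSystem a b c d :=
  ⟨fun ⟨_, h, hz⟩ => differenceSystem_of_zeroCurvature hcd h hz,
    fun h => ⟨_, hasCoefficients_laxEntries hcd, zeroCurvature_laxEntries hcd h⟩⟩

/-- Nondegeneracy extends to the axes: a zero of a or b there would propagate to the neighbouring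
interior index. -/
theorem IsSolution.ne_zero (h : IsSolution a b c d) (hn : NonvanishingInside a b) (n m : ℕ) :
    a (n + 1) m ≠ 0 ∧ b n (m + 1) ≠ 0 := by
  obtain ⟨-, -, hs⟩ := h
  constructor
  · intro h0
    refine (hn (n + 1) (m + 1) (by omega) (by omega)).1 ?_
    rw [hs.eq_a, h0, zero_mul]
  · intro h0
    refine (hn (n + 1) (m + 1) (by omega) (by omega)).2 ?_
    rw [hs.eq_b, h0, zero_mul]

theorem exists_invertible_zeroCurvature_iff (hab : ZeroBoundary a b) :
    (∃ e : LaxEntries, e.HasCoefficients a b c d ∧ e.Invertible ∧ e.ZeroCurvature) ↔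
      (IsSolution a b c d ∧ NonvanishingInside a b) := by
  constructor
  · rintro ⟨e, h, hi, hz⟩
    rw [invertible_iff] at hi
    have hcd : NonzeroDenominators c d := fun n m h0 => by
      have := ((zeroCurvature_iff h).1 hz n m).2.2.2.2.1
      rw [h0, zero_mul] at this
      exact (hi n m).2.2.1 this
    refine ⟨⟨hab, hcd, differenceSystem_of_zeroCurvature hcd h hz⟩, fun n m h0 h1 => ?_⟩
    obtain ⟨n, rfl⟩ := Nat.exists_eq_succ_of_ne_zero h0.ne'
    obtain ⟨m, rfl⟩ := Nat.exists_eq_succ_of_ne_zero h1.ne'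
    rw [(h _ _).2.2.1, (h _ _).2.2.2]
    exact ⟨neg_ne_zero.2 (mul_ne_zero (hi _ _).2.2.1 (hi _ _).1),
      neg_ne_zero.2 (mul_ne_zero (hi _ _).2.2.2 (hi _ _).2.1)⟩
  · rintro ⟨h, hn⟩
    obtain ⟨-, hcd, hs⟩ := id h
    refine ⟨laxEntries a b c d, hasCoefficients_laxEntries hcd, ?_, zeroCurvature_laxEntries hcd hs⟩
    rw [invertible_iff]
    intro n m
    exact ⟨laxEntries_α₂_ne_zero hcd n m, laxEntries_α₃_ne_zero hcd n m,
      div_ne_zero (neg_ne_zero.2 (h.ne_zero hn n m).1)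
        (laxEntries_α₂_ne_zero (a := a) (b := b) hcd (n + 1) m),
      div_ne_zero (neg_ne_zero.2 (h.ne_zero hn n m).2)
        (laxEntries_α₃_ne_zero (a := a) (b := b) hcd n (m + 1))⟩

end LaxPair

/-! ### Normality and nonvanishing moments. -/

section Perfect

variable {s s₁ s₂ : ℕ → ℂ} {P : ℕ → ℕ → ℂ[X]}

theorem IsHermitePade.swap {n m : ℕ} {p : ℂ[X]} (h : IsHermitePade s₁ s₂ n m p) :
    IsHermitePade s₂ s₁ m n p :=
  ⟨by rw [add_comm]; exact h.1, h.2.2, h.2.1⟩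

theorem IsPerfect.swap (h : IsPerfect s₁ s₂) : IsPerfect s₂ s₁ := fun n m =>
  ⟨fun p q hp hq => (h m n).1 p q hp.swap hq.swap,
    fun p hp h0 => by rw [add_comm]; exact (h m n).2 p hp.swap h0⟩

theorem IsHermitePadeTable.swap (h : IsHermitePadeTable s₁ s₂ P) :
    IsHermitePadeTable s₂ s₁ (fun n m => P m n) := fun n m => ⟨(h m n).1, (h m n).2.swap⟩

theorem IsHermitePadeTable.orth_fst (h : IsHermitePadeTable s₁ s₂ P) (n m : ℕ) :
    Orth s₁ n (P n m) := (isHermitePade_iff.1 (h n m).2).2.1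

theorem IsHermitePadeTable.orth_snd (h : IsHermitePadeTable s₁ s₂ P) (n m : ℕ) :
    Orth s₂ m (P n m) := (isHermitePade_iff.1 (h n m).2).2.2

theorem IsHermitePadeTable.natDegree_eq (h : IsHermitePadeTable s₁ s₂ P) (hp : IsPerfect s₁ s₂)
    (n m : ℕ) : (P n m).natDegree = n + m :=
  (hp n m).2 _ (h n m).2 (h n m).1.ne_zero

theorem IsPerfect.eq_zero (hp : IsPerfect s₁ s₂) {n m : ℕ} {p : ℂ[X]} (hd : p.degree < (n + m : ℕ))
    (h₁ : Orth s₁ n p) (h₂ : Orth s₂ m p) : p = 0 := by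
  by_contra h0
  have hd' := (natDegree_lt_iff_degree_lt h0).2 hd
  exact hd'.ne ((hp n m).2 p (isHermitePade_iff.2 ⟨hd'.le, h₁, h₂⟩) h0)

/-- One more vanishing moment would make `P n m` a denominator for `(n + 1, m)` of too small a
degree. -/
theorem IsPerfect.moment_ne_zero (hp : IsPerfect s₁ s₂) (h : IsHermitePadeTable s₁ s₂ P)
    (n m : ℕ) : moment s₁ (X ^ n * P n m) ≠ 0 := fun h0 => by
  refine (h n m).1.ne_zero (hp.eq_zero (n := n + 1) (m := m) ?_ ((h.orth_fst n m).succ h0)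
    (h.orth_snd n m))
  refine degree_le_natDegree.trans_lt ?_
  rw [h.natDegree_eq hp]
  exact_mod_cast (by omega : n + m < n + 1 + m)

theorem degree_sub_C_coeff_mul_lt {p q : ℂ[X]} {N : ℕ} (hp : p.degree < (N + 1 : ℕ))
    (hq : q.Monic) (hN : q.natDegree = N) : (p - C (p.coeff N) * q).degree < N := by
  rw [degree_lt_iff_coeff_zero]
  intro k hk
  rw [coeff_sub, coeff_C_mul]
  rcases hk.lt_or_eq with h | rfl
  · rw [coeff_eq_zero_of_degree_lt (hp.trans_le (by exact_mod_cast h)),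
      coeff_eq_zero_of_natDegree_lt (hN.trans_lt h), mul_zero, sub_zero]
  · rw [← hN, hq.coeff_natDegree, mul_one, sub_self]

/-- Normality is reached along the path from `(0, 0)` to `(n, 0)` and then up to `(n, m)`, which is
why `h₁` concerns only the bottom row. At each step the candidate is a multiple of the previous
table entry, and the new orthogonality condition kills the factor. -/
theorem isPerfect_of_table (h : IsHermitePadeTable s₁ s₂ P)
    (hd : ∀ n m, (P n m).natDegree = n + m) (h₁ : ∀ n, moment s₁ (X ^ n * P n 0) ≠ 0)
    (h₂ : ∀ n m, moment s₂ (X ^ m * P n m) ≠ 0) : IsPerfect s₁ s₂ := by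
  have eq_zero (n m : ℕ) : ∀ p : ℂ[X], p.degree < (n + m : ℕ) → Orth s₁ n p → Orth s₂ m p →
      p = 0 := by
    have step {n m : ℕ} {p : ℂ[X]} (hp : p.degree < (n + m + 1 : ℕ)) (o₁ : Orth s₁ n p)
        (o₂ : Orth s₂ m p) (ih : ∀ p : ℂ[X], p.degree < (n + m : ℕ) → Orth s₁ n p →
        Orth s₂ m p → p = 0) : p = C (p.coeff (n + m)) * P n m :=
      sub_eq_zero.1 (ih _ (degree_sub_C_coeff_mul_lt hp (h n m).1 (hd n m))
        (o₁.sub ((h.orth_fst n m).C_mul _)) (o₂.sub ((h.orth_snd n m).C_mul _)))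
    induction m with
    | zero =>
      induction n with
      | zero => intro p hp _ _; exact degree_eq_bot.1 (Nat.WithBot.lt_zero_iff.1 hp)
      | succ n ih =>
        intro p hp o₁ o₂
        have e := step (n := n) (m := 0) hp (o₁.mono (by omega)) o₂ ih
        have e' := o₁ n (by omega)
        rw [e, mul_left_comm, moment_C_mul] at e'
        rw [e, (mul_eq_zero.1 e').resolve_right (h₁ n), C_0, zero_mul]
    | succ m ih =>
      intro p hp o₁ o₂
      have e := step (n := n) (m := m) hp o₁ (o₂.mono (by omega)) ih
      have e' := o₂ m (by omega)
      rw [e, mul_left_comm, moment_C_mul] at e'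
      rw [e, (mul_eq_zero.1 e').resolve_right (h₂ n m), C_0, zero_mul]
  have eq_C_mul (n m : ℕ) (p : ℂ[X]) (hp : IsHermitePade s₁ s₂ n m p) :
      p = C (p.coeff (n + m)) * P n m := by
    obtain ⟨hp, o₁, o₂⟩ := isHermitePade_iff.1 hp
    refine sub_eq_zero.1 (eq_zero n m _ (degree_sub_C_coeff_mul_lt ?_ (h n m).1 (hd n m))
        (o₁.sub ((h.orth_fst n m).C_mul _)) (o₂.sub ((h.orth_snd n m).C_mul _)))
    exact (degree_le_of_natDegree_le hp).trans_lt (by exact_mod_cast Nat.lt_succ_self _)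
  intro n m
  refine ⟨fun p q hp hq h0 => ?_, fun p hp h0 => ?_⟩
  · have hp' := eq_C_mul n m p hp
    have hc : p.coeff (n + m) ≠ 0 := fun hc => h0 (by rw [hp', hc, C_0, zero_mul])
    refine ⟨q.coeff (n + m) / p.coeff (n + m), ?_⟩
    rw [hp', ← mul_assoc, ← C_mul, ← hp', div_mul_cancel₀ _ hc]
    exact eq_C_mul n m q hq
  · have hp' := eq_C_mul n m p hp
    have hc : p.coeff (n + m) ≠ 0 := fun hc => h0 (by rw [hp', hc, C_0, zero_mul])
    rw [hp', natDegree_C_mul hc, hd]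

end Perfect

/-! ### From perfect pairs to nearest neighbour relations and solutions. -/

section NearestNeighbour

variable {s₁ s₂ : ℕ → ℂ} {P : ℕ → ℕ → ℂ[X]} {a b c d : ℕ → ℕ → ℂ}

theorem NearestNeighbour.swap (h : NearestNeighbour P a b c d) :
    NearestNeighbour (fun n m => P m n) (fun n m => b m n) (fun n m => a m n) (fun n m => d m n)
      (fun n m => c m n) := by
  have h1 (n m : ℕ) : prevFst (fun n m => P m n) n m = prevSnd P m n := by cases n <;> rfl
  have h2 (n m : ℕ) : prevSnd (fun n m => P m n) n m = prevFst P m n := by cases m <;> rfl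
  constructor
  · intro n m
    rw [h1, h2]
    exact (h.2 m n).trans (sub_right_comm _ _ _)
  · intro n m
    rw [h1, h2]
    exact (h.1 m n).trans (sub_right_comm _ _ _)

theorem NearestNeighbour.sub_eq (h : NearestNeighbour P a b c d) (n m : ℕ) :
    P n (m + 1) = P (n + 1) m + C (c n m - d n m) * P n m := by
  rw [h.1, h.2, C_sub]; ring

theorem ZeroBoundary.C_mul_prevFst (h : ZeroBoundary a b) (P : ℕ → ℕ → ℂ[X]) (n m : ℕ) :
    C (a n m) * prevFst P n m = C (a n m) * P (n - 1) m := by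
  cases n with
  | zero => simp [h.1]
  | succ n => rfl

theorem ZeroBoundary.C_mul_prevSnd (h : ZeroBoundary a b) (P : ℕ → ℕ → ℂ[X]) (n m : ℕ) :
    C (b n m) * prevSnd P n m = C (b n m) * P n (m - 1) := by
  cases m with
  | zero => simp [h.2]
  | succ m => rfl

theorem moment_succ_snd (h : NearestNeighbour P a b c d) (ht : IsHermitePadeTable s₁ s₂ P)
    (n m : ℕ) : moment s₁ (X ^ n * P n (m + 1)) = (c n m - d n m) * moment s₁ (X ^ n * P n m) := by
  rw [h.sub_eq, mul_add, map_add, ht.orth_fst (n + 1) m n (by omega), zero_add, mul_left_comm,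
    moment_C_mul]

theorem moment_succ_fst (h : NearestNeighbour P a b c d) (ht : IsHermitePadeTable s₁ s₂ P)
    (n m : ℕ) :
    moment s₁ (X ^ (n + 1) * P (n + 1) m) = a (n + 1) m * moment s₁ (X ^ n * P n m) := by
  have e : X * P (n + 1) m = P (n + 2) m + C (c (n + 1) m) * P (n + 1) m +
      C (a (n + 1) m) * P n m + C (b (n + 1) m) * prevSnd P (n + 1) m := by
    rw [h.1 (n + 1) m, prevFst]; ring
  have e' : X ^ (n + 1) * P (n + 1) m =
      X ^ n * P (n + 2) m + C (c (n + 1) m) * (X ^ n * P (n + 1) m) +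
      C (a (n + 1) m) * (X ^ n * P n m) + C (b (n + 1) m) * (X ^ n * prevSnd P (n + 1) m) := by
    rw [pow_succ, mul_assoc, e]; ring
  have h0 : moment s₁ (X ^ n * prevSnd P (n + 1) m) = 0 := by
    cases m with
    | zero => simp [prevSnd]
    | succ m => exact ht.orth_fst (n + 1) m n (by omega)
  rw [e', map_add, map_add, map_add, moment_C_mul, moment_C_mul, moment_C_mul, h0,
    ht.orth_fst (n + 2) m n (by omega), ht.orth_fst (n + 1) m n (by omega)]
  ring

/-- Multiplying by `X ^ 2` keeps the indices of the second and third highest coefficients free of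
truncated subtraction: in `X ^ 2 * P n m` they are `n + m + 1` and `n + m`. -/
theorem coeff_compatibility (h : NearestNeighbour P a b c d) (hab : ZeroBoundary a b)
    (hd : ∀ n m, (P n m).natDegree = n + m) (hm : ∀ n m, (P n m).Monic) (n m : ℕ) :
    c n (m + 1) + d n m = d (n + 1) m + c n m ∧
      c n (m + 1) * d n m - (a n (m + 1) + b n (m + 1)) =
        d (n + 1) m * c n m - (a (n + 1) m + b (n + 1) m) := by
  have h1 (n m : ℕ) : (P n m).coeff (n + m) = 1 := by rw [← hd]; exact hm n m
  have ha (n m : ℕ) : a n m * (X ^ 2 * P (n - 1) m).coeff (n + m + 1) = a n m := by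
    cases n with
    | zero => rw [hab.1, zero_mul]
    | succ n =>
      rw [Nat.add_sub_cancel, show n + 1 + m + 1 = n + m + 2 by ring, coeff_X_pow_mul, h1, mul_one]
  have hb (n m : ℕ) : b n m * (X ^ 2 * P n (m - 1)).coeff (n + m + 1) = b n m := by
    cases m with
    | zero => rw [hab.2, zero_mul]
    | succ m =>
      rw [Nat.add_sub_cancel, show n + (m + 1) + 1 = n + m + 2 by ring, coeff_X_pow_mul, h1,
        mul_one]
  have ha' (n m : ℕ) : a n m * (X ^ 2 * P (n - 1) m).coeff (n + m + 2) = 0 := by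
    cases n with
    | zero => rw [hab.1, zero_mul]
    | succ n =>
      rw [coeff_X_pow_mul, coeff_eq_zero_of_natDegree_lt, mul_zero]
      rw [hd]; omega
  have hb' (n m : ℕ) : b n m * (X ^ 2 * P n (m - 1)).coeff (n + m + 2) = 0 := by
    cases m with
    | zero => rw [hab.2, zero_mul]
    | succ m =>
      rw [coeff_X_pow_mul, coeff_eq_zero_of_natDegree_lt, mul_zero]
      rw [hd]; omega
  have ec (n m k : ℕ) : (X ^ 2 * P (n + 1) m).coeff (k + 1) = (X ^ 2 * P n m).coeff k -
      c n m * (X ^ 2 * P n m).coeff (k + 1) - a n m * (X ^ 2 * P (n - 1) m).coeff (k + 1)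
      - b n m * (X ^ 2 * P n (m - 1)).coeff (k + 1) := by
    have e : X ^ 2 * P (n + 1) m = X * (X ^ 2 * P n m) - C (c n m) * (X ^ 2 * P n m) -
        C (a n m) * (X ^ 2 * P (n - 1) m) - C (b n m) * (X ^ 2 * P n (m - 1)) := by
      rw [h.1, hab.C_mul_prevFst, hab.C_mul_prevSnd]; ring
    rw [e]
    simp only [coeff_sub, coeff_C_mul, coeff_X_mul]
  have ed (n m k : ℕ) : (X ^ 2 * P n (m + 1)).coeff (k + 1) = (X ^ 2 * P n m).coeff k -
      d n m * (X ^ 2 * P n m).coeff (k + 1) - a n m * (X ^ 2 * P (n - 1) m).coeff (k + 1)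
      - b n m * (X ^ 2 * P n (m - 1)).coeff (k + 1) := by
    have e : X ^ 2 * P n (m + 1) = X * (X ^ 2 * P n m) - C (d n m) * (X ^ 2 * P n m) -
        C (a n m) * (X ^ 2 * P (n - 1) m) - C (b n m) * (X ^ 2 * P n (m - 1)) := by
      rw [h.2, hab.C_mul_prevFst, hab.C_mul_prevSnd]; ring
    rw [e]
    simp only [coeff_sub, coeff_C_mul, coeff_X_mul]
  have h2 (n m : ℕ) : (X ^ 2 * P n m).coeff (n + m + 2) = 1 := by rw [coeff_X_pow_mul, h1]
  have σc (n m : ℕ) : (X ^ 2 * P (n + 1) m).coeff (n + 1 + m + 1) =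
      (X ^ 2 * P n m).coeff (n + m + 1) - c n m := by
    have := ec n m (n + m + 1)
    rw [ha', hb', h2] at this
    rw [show n + 1 + m + 1 = n + m + 1 + 1 by ring, this]; ring
  have σd (n m : ℕ) : (X ^ 2 * P n (m + 1)).coeff (n + (m + 1) + 1) =
      (X ^ 2 * P n m).coeff (n + m + 1) - d n m := by
    have := ed n m (n + m + 1)
    rw [ha', hb', h2] at this
    rw [show n + (m + 1) + 1 = n + m + 1 + 1 by ring, this]; ring
  have τc (n m : ℕ) : (X ^ 2 * P (n + 1) m).coeff (n + 1 + m) = (X ^ 2 * P n m).coeff (n + m)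
      - c n m * (X ^ 2 * P n m).coeff (n + m + 1) - (a n m + b n m) := by
    have := ec n m (n + m)
    rw [ha, hb] at this
    rw [show n + 1 + m = n + m + 1 by ring, this]; ring
  have τd (n m : ℕ) : (X ^ 2 * P n (m + 1)).coeff (n + (m + 1)) = (X ^ 2 * P n m).coeff (n + m)
      - d n m * (X ^ 2 * P n m).coeff (n + m + 1) - (a n m + b n m) := by
    have := ed n m (n + m)
    rw [ha, hb] at this
    rw [show n + (m + 1) = n + m + 1 by ring, this]; ring
  -- Both coefficients of `P (n + 1) (m + 1)` are computed along the two paths from `(n, m)`.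
  have σ1 := σc n (m + 1)
  rw [σd (n + 1) m, σc n m, σd n m] at σ1
  have τ1 := τc n (m + 1)
  rw [τd (n + 1) m, τc n m, τd n m, σc n m, σd n m] at τ1
  have hs : c n (m + 1) + d n m = d (n + 1) m + c n m := by linear_combination σ1
  refine ⟨hs, ?_⟩
  linear_combination (X ^ 2 * P n m).coeff (n + m + 1) * hs - τ1

theorem IsPerfect.isSolution (hp : IsPerfect s₁ s₂) (ht : IsHermitePadeTable s₁ s₂ P)
    (hab : ZeroBoundary a b) (h : NearestNeighbour P a b c d) :
    IsSolution a b c d ∧ NonvanishingInside a b := by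
  have hcd : NonzeroDenominators c d := fun n m h0 => by
    have := moment_succ_snd h ht n m
    rw [h0, zero_mul] at this
    exact hp.moment_ne_zero ht n (m + 1) this
  refine ⟨⟨hab, hcd, (differenceSystem_iff hcd).2 fun n m => ?_⟩, fun n m hn hm => ?_⟩
  · obtain ⟨e1, e2⟩ := coeff_compatibility h hab (ht.natDegree_eq hp) (fun n m => (ht n m).1) n m
    refine ⟨e1, e2, ?_, ?_⟩
    -- Two evaluations of the moment at `(n + 1, m + 1)`, both reduced to the nonzero moment at `(n,
    -- m)`.
    · have h1 := moment_succ_fst h ht n (m + 1)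
      rw [moment_succ_snd h ht, moment_succ_snd h ht, moment_succ_fst h ht] at h1
      refine mul_right_cancel₀ (hp.moment_ne_zero ht n m) ?_
      linear_combination -h1
    · have h1 := moment_succ_fst h.swap ht.swap m (n + 1)
      rw [moment_succ_snd h.swap ht.swap, moment_succ_snd h.swap ht.swap,
        moment_succ_fst h.swap ht.swap] at h1
      refine mul_right_cancel₀ (hp.swap.moment_ne_zero ht.swap m n) ?_
      linear_combination h1
  · obtain ⟨n, rfl⟩ := Nat.exists_eq_succ_of_ne_zero hn.ne'
    obtain ⟨m, rfl⟩ := Nat.exists_eq_succ_of_ne_zero hm.ne'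
    refine ⟨fun h0 => ?_, fun h0 => ?_⟩
    · have := moment_succ_fst h ht n (m + 1)
      rw [h0, zero_mul] at this
      exact hp.moment_ne_zero ht _ _ this
    · have := moment_succ_fst h.swap ht.swap m (n + 1)
      rw [h0, zero_mul] at this
      exact hp.swap.moment_ne_zero ht.swap _ _ this

/-- For a perfect system the step in the first direction satisfies a nearest neighbour relation. -/
theorem IsPerfect.recurrence_fst (hp : IsPerfect s₁ s₂) (ht : IsHermitePadeTable s₁ s₂ P)
    (ha : ∀ n m, moment s₁ (X ^ (n + 1) * P (n + 1) m) = a (n + 1) m * moment s₁ (X ^ n * P n m))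
    (hb : ∀ n m, moment s₂ (X ^ (m + 1) * P n (m + 1)) = b n (m + 1) * moment s₂ (X ^ m * P n m))
    (n m : ℕ) :
    P (n + 1) m = (X - C ((X * P n m - P (n + 1) m).coeff (n + m))) * P n m
      - C (a n m) * prevFst P n m - C (b n m) * prevSnd P n m := by
  -- The constant `t` brings the degree below `n + m`. Subtracting the `a` and `b` terms restores
  -- the last missing orthogonality for `s₁` and `s₂`, and normality leaves only zero.
  set t := (X * P n m - P (n + 1) m).coeff (n + m) with t_def
  set R := X * P n m - P (n + 1) m - C t * P n m with hR
  suffices R - C (a n m) * prevFst P n m - C (b n m) * prevSnd P n m = 0 by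
    rw [hR] at this; linear_combination -this
  have hdeg : ((X : ℂ[X]) * P n m - P (n + 1) m).degree < (n + m + 1 : ℕ) := by
    have e : (n + m + 1 : ℕ) = (X * P n m).natDegree := by
      rw [natDegree_X_mul (ht n m).1.ne_zero, ht.natDegree_eq hp]
    have e' : (n + m + 1 : ℕ) = (P (n + 1) m).natDegree := by rw [ht.natDegree_eq hp]; ring
    have m1 : (X * P n m).Monic := monic_X.mul (ht n m).1
    have hdd : ((X : ℂ[X]) * P n m).degree = (n + m + 1 : ℕ) := by
      rw [degree_eq_natDegree m1.ne_zero, e]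
    rw [← hdd]
    refine degree_sub_lt_left ?_ m1.ne_zero ?_
    · rw [hdd, degree_eq_natDegree (ht _ _).1.ne_zero, e']
    · rw [m1.leadingCoeff, (ht _ _).1.leadingCoeff]
  have hRdeg : R.degree < (n + m : ℕ) :=
    degree_sub_C_coeff_mul_lt hdeg (ht n m).1 (ht.natDegree_eq hp n m)
  have hdle (i j : ℕ) (r : ℂ) (hij : i + j < n + m) : (C r * P i j).degree < (n + m : ℕ) := by
    refine degree_le_natDegree.trans_lt ?_
    have := (natDegree_C_mul_le r (P i j)).trans (ht.natDegree_eq hp i j).le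
    exact_mod_cast this.trans_lt hij
  refine hp.eq_zero (n := n) (m := m) ?_ ?_ ?_
  · have h1 : (C (a n m) * prevFst P n m).degree < (n + m : ℕ) := by
      cases n with
      | zero => simp [prevFst]
      | succ n => exact hdle _ _ _ (by omega)
    have h2 : (C (b n m) * prevSnd P n m).degree < (n + m : ℕ) := by
      cases m with
      | zero => simp [prevSnd]
      | succ m => exact hdle _ _ _ (by omega)
    exact (degree_sub_le _ _).trans_lt (max_lt ((degree_sub_le _ _).trans_lt (max_lt hRdeg h1)) h2)
  · cases n with
    | zero => intro k hk; omega
    | succ n =>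
      have hS : Orth s₁ (n + 1) (C (b (n + 1) m) * prevSnd P (n + 1) m) := by
        cases m with
        | zero => simp [prevSnd, Orth]
        | succ m => exact (ht.orth_fst _ _).C_mul _
      refine Orth.sub (Orth.succ (Orth.sub ?_ ((ht.orth_fst n m).C_mul _)) ?_) hS
      · exact ((ht.orth_fst (n + 1) m).X_mul.sub ((ht.orth_fst (n + 2) m).mono (by omega))).sub
          (((ht.orth_fst (n + 1) m).mono (by omega)).C_mul _)
      · rw [hR, prevFst, mul_sub, mul_sub, mul_sub, map_sub, map_sub, map_sub, ← mul_assoc,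
          ← pow_succ, mul_left_comm _ (C _), mul_left_comm _ (C _), moment_C_mul, moment_C_mul, ha,
          ht.orth_fst (n + 2) m n (by omega), ht.orth_fst (n + 1) m n (by omega)]
        ring
  · cases m with
    | zero => intro k hk; omega
    | succ m =>
      have hS : Orth s₂ (m + 1) (C (a n (m + 1)) * prevFst P n (m + 1)) := by
        cases n with
        | zero => simp [prevFst, Orth]
        | succ n => exact (ht.orth_snd _ _).C_mul _
      rw [sub_right_comm]
      refine Orth.sub (Orth.succ (Orth.sub ?_ ((ht.orth_snd n m).C_mul _)) ?_) hS
      · exact ((ht.orth_snd n (m + 1)).X_mul.sub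
          ((ht.orth_snd (n + 1) (m + 1)).mono (by omega))).sub
          (((ht.orth_snd n (m + 1)).mono (by omega)).C_mul _)
      · rw [hR, prevSnd, mul_sub, mul_sub, mul_sub, map_sub, map_sub, map_sub, ← mul_assoc,
          ← pow_succ, mul_left_comm _ (C _), mul_left_comm _ (C _), moment_C_mul, moment_C_mul, hb,
          ht.orth_snd (n + 1) (m + 1) m (by omega), ht.orth_snd n (m + 1) m (by omega)]
        ring

end NearestNeighbour

/-! ### Three-term recurrences and Favard's theorem. -/

section Favard

/-- The monic polynomials defined by a three-term recurrence relation. -/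
noncomputable def threeTerm (a c : ℕ → ℂ) : ℕ → ℂ[X]
  | 0 => 1
  | 1 => X - C (c 0)
  | n + 2 => (X - C (c (n + 1))) * threeTerm a c (n + 1) - C (a (n + 1)) * threeTerm a c n

variable {a c : ℕ → ℂ}

theorem threeTerm_succ (h0 : a 0 = 0) (n : ℕ) : threeTerm a c (n + 1) =
    (X - C (c n)) * threeTerm a c n - C (a n) * threeTerm a c (n - 1) := by
  cases n with
  | zero => simp [threeTerm, h0]
  | succ n => rfl

theorem threeTerm_eq {p : ℕ → ℂ[X]} (h0 : p 0 = 1) (h1 : p 1 = X - C (c 0))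
    (h : ∀ n, p (n + 2) = (X - C (c (n + 1))) * p (n + 1) - C (a (n + 1)) * p n) (n : ℕ) :
    p n = threeTerm a c n := by
  induction n using Nat.twoStepInduction with
  | zero => exact h0
  | one => exact h1
  | more n ih ih' => rw [h, ih, ih', threeTerm]

theorem Monic.X_sub_C_mul_sub {p q : ℂ[X]} {n : ℕ} (hp : p.Monic) (hpn : p.natDegree = n)
    (hq : q.natDegree ≤ n) (r s : ℂ) :
    ((X - C r) * p - C s * q).Monic ∧ ((X - C r) * p - C s * q).natDegree = n + 1 := by
  have h1 : ((X - C r) * p).Monic := (monic_X_sub_C r).mul hp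
  have h2 : ((X - C r) * p).natDegree = n + 1 := by
    rw [(monic_X_sub_C r).natDegree_mul hp, natDegree_X_sub_C, hpn, add_comm]
  have h3 : (C s * q).natDegree < ((X - C r) * p).natDegree :=
    ((natDegree_C_mul_le _ _).trans hq).trans_lt (by omega)
  refine ⟨h1.sub_of_left ?_, ?_⟩
  · rw [degree_eq_natDegree h1.ne_zero]
    exact degree_le_natDegree.trans_lt (by exact_mod_cast h3)
  · rw [natDegree_sub_eq_left_of_natDegree_lt h3, h2]

theorem monic_threeTerm (n : ℕ) :
    (threeTerm a c n).Monic ∧ (threeTerm a c n).natDegree = n := by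
  induction n using Nat.twoStepInduction with
  | zero => exact ⟨monic_one, natDegree_one⟩
  | one => exact ⟨monic_X_sub_C _, natDegree_X_sub_C _⟩
  | more n ih ih' => exact Monic.X_sub_C_mul_sub ih'.1 ih'.2 (by rw [ih.2]; omega) _ _

/-- Favard's theorem. -/
theorem exists_orth_threeTerm (h0 : a 0 = 0) (ha : ∀ n, a (n + 1) ≠ 0) : ∃ s : ℕ → ℂ,
    ∀ n, Orth s n (threeTerm a c n) ∧ moment s (X ^ n * threeTerm a c n) ≠ 0 := by
  let S : Polynomial.Sequence ℂ := ⟨threeTerm a c, fun n => by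
    rw [degree_eq_natDegree (monic_threeTerm n).1.ne_zero, (monic_threeTerm n).2]⟩
  have hS (n : ℕ) : IsUnit (S n).leadingCoeff := by
    rw [show (S n).leadingCoeff = 1 from (monic_threeTerm n).1]; exact isUnit_one
  -- The polynomials form a basis, so a functional may be prescribed as 1 on the zeroth and 0 on the
  -- others; the recurrence then yields all orthogonality.
  obtain ⟨s, hs⟩ := exists_moment_eq ((S.basis hS).constr ℂ fun n => if n = 0 then (1 : ℂ) else 0)
  have hv (n : ℕ) : moment s (threeTerm a c n) = if n = 0 then (1 : ℂ) else 0 := by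
    have := (S.basis hS).constr_basis ℂ (fun n => if n = 0 then (1 : ℂ) else 0) n
    rwa [S.basis_eq_self hS, ← hs] at this
  have step (k n : ℕ) : moment s (X ^ (k + 1) * threeTerm a c n) =
      moment s (X ^ k * threeTerm a c (n + 1)) + c n * moment s (X ^ k * threeTerm a c n) +
        a n * moment s (X ^ k * threeTerm a c (n - 1)) := by
    rw [← moment_C_mul, ← moment_C_mul, ← map_add, ← map_add, threeTerm_succ h0]
    congr 1; ring
  have ho (k : ℕ) : ∀ n, k < n → moment s (X ^ k * threeTerm a c n) = 0 := by
    induction k with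
    | zero => intro n hn; rw [pow_zero, one_mul, hv, if_neg hn.ne']
    | succ k ih =>
      intro n hn
      rw [step, ih _ (by omega), ih _ (by omega), ih _ (by omega)]; ring
  refine ⟨s, fun n => ⟨fun k hk => ho k n hk, ?_⟩⟩
  induction n with
  | zero => rw [pow_zero, one_mul, hv, if_pos rfl]; exact one_ne_zero
  | succ n ih =>
    rw [step, ho _ _ (by omega), ho _ _ (by omega), mul_zero, zero_add, zero_add]
    exact mul_ne_zero (ha n) ih

end Favard

/-! ### From solutions to perfect pairs, and the initial value problem. -/

section Construction

variable {a b c d : ℕ → ℕ → ℂ}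

/-- The polynomials generated by the nearest neighbour recurrence relations. -/
noncomputable def table (a c d : ℕ → ℕ → ℂ) : ℕ → ℕ → ℂ[X]
  | n, 0 => threeTerm (fun k => a k 0) (fun k => c k 0) n
  | n, m + 1 => table a c d (n + 1) m + C (c n m - d n m) * table a c d n m

theorem monic_table (n m : ℕ) :
    (table a c d n m).Monic ∧ (table a c d n m).natDegree = n + m := by
  induction m generalizing n with
  | zero => simpa [table] using monic_threeTerm n
  | succ m ih =>
    obtain ⟨h1, h2⟩ := ih (n + 1)
    have h3 : (C (c n m - d n m) * table a c d n m).natDegree < (table a c d (n + 1) m).natDegree :=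
      (natDegree_C_mul_le _ _).trans_lt (by rw [(ih n).2, h2]; omega)
    rw [table]
    refine ⟨h1.add_of_left ?_, ?_⟩
    · rw [degree_eq_natDegree h1.ne_zero]
      exact degree_le_natDegree.trans_lt (by exact_mod_cast h3)
    · rw [natDegree_add_eq_left_of_natDegree_lt h3, h2]; ring

/-- `table` builds in the difference of the two relations, so only the first needs proof, by
induction on the row. The truncated indices `n - 1` and `m - 1` are harmless because their
coefficients vanish on the boundary. -/
theorem IsSolution.nearestNeighbour (h : IsSolution a b c d) :
    NearestNeighbour (table a c d) a b c d := by
  obtain ⟨hab, hcd, hs⟩ := h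
  rw [differenceSystem_iff hcd] at hs
  have key (n m : ℕ) : table a c d (n + 1) m = (X - C (c n m)) * table a c d n m -
      C (a n m) * table a c d (n - 1) m - C (b n m) * table a c d n (m - 1) := by
    induction m generalizing n with
    | zero =>
      rw [hab.2, C_0, zero_mul, sub_zero]
      exact threeTerm_succ (a := fun k => a k 0) (hab.1 0) n
    | succ m ih =>
      obtain ⟨e1, e2, -, -⟩ := hs n m
      have ea : C (a n (m + 1)) * (C (c (n - 1) m - d (n - 1) m) * table a c d (n - 1) m) =
          C (c n m - d n m) * (C (a n m) * table a c d (n - 1) m) := by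
        cases n with
        | zero => rw [hab.1, hab.1]; simp
        | succ n =>
          rw [← mul_assoc, ← mul_assoc, ← C_mul, ← C_mul, Nat.add_sub_cancel, (hs n m).2.2.1,
            mul_comm (a _ _)]
      have ea' : C (a n (m + 1)) * table a c d (n - 1) (m + 1) = C (a n (m + 1)) *
          (table a c d n m + C (c (n - 1) m - d (n - 1) m) * table a c d (n - 1) m) := by
        cases n with
        | zero => rw [hab.1]; simp
        | succ n => rfl
      have eb : C (b (n + 1) m) * table a c d n m = C (b (n + 1) m) * table a c d (n + 1) (m - 1) +
          C (c n m - d n m) * (C (b n m) * table a c d n (m - 1)) := by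
        cases m with
        | zero => rw [hab.2, hab.2]; simp
        | succ m =>
          rw [Nat.add_sub_cancel, table, mul_add, ← mul_assoc, ← mul_assoc, ← C_mul, ← C_mul,
            (hs n m).2.2.2, mul_comm (b _ _)]
      have i0 := ih n
      have i1 := ih (n + 1)
      have E1 := congrArg C e1
      have E2 := congrArg C e2
      rw [Nat.add_sub_cancel] at i1
      rw [ea', mul_add, ea, Nat.add_sub_cancel, table, table, i1]
      simp only [C_add, C_sub, C_mul] at *
      linear_combination (C (c n m) - C (d n m)) * i0 + eb + table a c d (n + 1) m * E1 -
        table a c d n m * (E2 - C (c n m) * E1)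
  refine ⟨fun n m => ?_, fun n m => ?_⟩
  · rw [hab.C_mul_prevFst, hab.C_mul_prevSnd, key]
  · rw [hab.C_mul_prevFst, hab.C_mul_prevSnd, table, key, C_sub]; ring

theorem ZeroBoundary.row (hab : ZeroBoundary a b) {P : ℕ → ℕ → ℂ[X]}
    (h : NearestNeighbour P a b c d) (n : ℕ) : P (n + 2) 0 =
      (X - C (c (n + 1) 0)) * P (n + 1) 0 - C (a (n + 1) 0) * P n 0 := by
  rw [h.1, hab.C_mul_prevSnd, hab.2, C_0, zero_mul, sub_zero, prevFst]

theorem NearestNeighbour.row_zero {P : ℕ → ℕ → ℂ[X]}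
    (h : NearestNeighbour P a b c d) : P 1 0 = (X - C (c 0 0)) * P 0 0 := by
  simp [h.1, prevFst, prevSnd]

theorem ZeroBoundary.swap (hab : ZeroBoundary a b) :
    ZeroBoundary (fun n m => b m n) (fun n m => a m n) := ⟨hab.2, hab.1⟩

/-- A table of polynomials satisfying nonsingular nearest neighbour relations is orthogonal with
respect to a functional in the first direction. -/
theorem exists_orth_fst (hab : ZeroBoundary a b) (ha : ∀ n, a (n + 1) 0 ≠ 0)
    (hcd : NonzeroDenominators c d) {P : ℕ → ℕ → ℂ[X]} (h0 : P 0 0 = 1)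
    (h : NearestNeighbour P a b c d) :
    ∃ s : ℕ → ℂ, ∀ n m, Orth s n (P n m) ∧ moment s (X ^ n * P n m) ≠ 0 := by
  obtain ⟨s, hs⟩ := exists_orth_threeTerm (a := fun n => a n 0) (c := fun n => c n 0) (hab.1 0) ha
  refine ⟨s, fun n m => ?_⟩
  induction m generalizing n with
  | zero =>
    have e : P n 0 = threeTerm (fun n => a n 0) (fun n => c n 0) n :=
      threeTerm_eq (p := fun n => P n 0) (a := fun n => a n 0) (c := fun n => c n 0) h0
        (by rw [h.row_zero, h0, mul_one]) (fun n => hab.row h n) n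
    rw [e]
    exact hs n
  | succ m ih =>
    -- Passing up a row loses no orthogonality and multiplies the critical moment by `c n m - d n
    -- m`.
    rw [h.sub_eq]
    refine ⟨((ih (n + 1)).1.mono (by omega)).add ((ih n).1.C_mul _), ?_⟩
    rw [mul_add, map_add, (ih (n + 1)).1 n (by omega), zero_add, mul_left_comm, moment_C_mul]
    exact mul_ne_zero (hcd n m) (ih n).2

theorem IsSolution.exists_isPerfect (h : IsSolution a b c d) (hn : NonvanishingInside a b) :
    ∃ (s₁ s₂ : ℕ → ℂ) (P : ℕ → ℕ → ℂ[X]), IsPerfect s₁ s₂ ∧ IsHermitePadeTable s₁ s₂ P ∧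
      NearestNeighbour P a b c d := by
  have hN := h.nearestNeighbour
  have hne := h.ne_zero hn
  obtain ⟨hab, hcd, hs⟩ := h
  obtain ⟨s₁, h₁⟩ := exists_orth_fst hab (fun n => (hne n 0).1) hcd rfl hN
  obtain ⟨s₂, h₂⟩ := exists_orth_fst hab.swap (fun n => (hne 0 n).2)
    (fun n m => sub_ne_zero.2 (sub_ne_zero.1 (hcd m n)).symm) rfl hN.swap
  have ht : IsHermitePadeTable s₁ s₂ (table a c d) := fun n m =>
    ⟨(monic_table n m).1, isHermitePade_iff.2 ⟨(monic_table n m).2.le, (h₁ n m).1, (h₂ m n).1⟩⟩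
  exact ⟨s₁, s₂, _, isPerfect_of_table ht (fun n m => (monic_table n m).2) (fun n => (h₁ n 0).2)
    (fun n m => (h₂ m n).2), ht, hN⟩

theorem IsPerfect.exists_nearestNeighbour {s₁ s₂ : ℕ → ℂ} {P : ℕ → ℕ → ℂ[X]}
    (hp : IsPerfect s₁ s₂) (ht : IsHermitePadeTable s₁ s₂ P) :
    ∃ a b c d : ℕ → ℕ → ℂ, ZeroBoundary a b ∧ NearestNeighbour P a b c d := by
  let a : ℕ → ℕ → ℂ := fun n m => match n with
    | 0 => 0
    | n + 1 => moment s₁ (X ^ (n + 1) * P (n + 1) m) / moment s₁ (X ^ n * P n m)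
  let b : ℕ → ℕ → ℂ := fun n m => match m with
    | 0 => 0
    | m + 1 => moment s₂ (X ^ (m + 1) * P n (m + 1)) / moment s₂ (X ^ m * P n m)
  have ha (n m : ℕ) :
      moment s₁ (X ^ (n + 1) * P (n + 1) m) = a (n + 1) m * moment s₁ (X ^ n * P n m) :=
    (div_mul_cancel₀ _ (hp.moment_ne_zero ht n m)).symm
  have hb (n m : ℕ) :
      moment s₂ (X ^ (m + 1) * P n (m + 1)) = b n (m + 1) * moment s₂ (X ^ m * P n m) :=
    (div_mul_cancel₀ _ (hp.swap.moment_ne_zero ht.swap m n)).symm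
  have h1 := hp.recurrence_fst ht ha hb
  have h2 := hp.swap.recurrence_fst ht.swap (a := fun n m => b m n) (b := fun n m => a m n)
    (fun n m => hb m n) (fun n m => ha m n)
  -- Both relations share `a` and `b`, since these are moment ratios independent of the direction of
  -- the step. The order `m + n` comes from the exchange of indices.
  refine ⟨a, b, _, fun n m => (X * P n m - P n (m + 1)).coeff (m + n), ⟨fun _ => rfl, fun _ => rfl⟩,
    h1, fun n m => ?_⟩
  have e1 : prevFst (fun n m => P m n) m n = prevSnd P n m := by cases m <;> rfl
  have e2 : prevSnd (fun n m => P m n) m n = prevFst P n m := by cases n <;> rfl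
  have := h2 m n
  rw [e1, e2] at this
  exact this.trans (sub_right_comm _ _ _)

theorem eq_of_threeTerm_eq {p q : ℂ[X]} {n : ℕ} (hp : p.Monic) (hpn : p.natDegree = n + 1)
    (hq : q.Monic) (hqn : q.natDegree = n) {x x' y y' : ℂ}
    (h : (X - C x) * p - C y * q = (X - C x') * p - C y' * q) : x = x' ∧ y = y' := by
  have h1 : C (x - x') * p = C (y' - y) * q := by
    rw [C_sub, C_sub]; linear_combination -h
  have hx : x - x' = 0 := by
    have := congrArg (fun r => coeff r (n + 1)) h1
    simp only [coeff_C_mul] at this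
    rwa [← hpn, hp.coeff_natDegree, mul_one, coeff_eq_zero_of_natDegree_lt (by omega),
      mul_zero] at this
  have hy : y' - y = 0 := by
    rw [hx, C_0, zero_mul, eq_comm, mul_eq_zero, C_eq_zero] at h1
    exact h1.resolve_right hq.ne_zero
  exact ⟨sub_eq_zero.1 hx, (sub_eq_zero.1 hy).symm⟩

/-- The recurrence coefficients of the marginal polynomials are determined by the polynomials. -/
theorem ZeroBoundary.row_coefficients (hab : ZeroBoundary a b) {P : ℕ → ℕ → ℂ[X]}
    (h : NearestNeighbour P a b c d) (hm : ∀ n, (P n 0).Monic) (hd : ∀ n, (P n 0).natDegree = n)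
    {c₀ a₀ : ℕ → ℂ} (h0 : P 1 0 = (X - C (c₀ 0)) * P 0 0)
    (h1 : ∀ n, P (n + 2) 0 = (X - C (c₀ (n + 1))) * P (n + 1) 0 - C (a₀ (n + 1)) * P n 0) :
    (∀ n, c n 0 = c₀ n) ∧ ∀ n, a (n + 1) 0 = a₀ (n + 1) := by
  have key (n : ℕ) := eq_of_threeTerm_eq (hm (n + 1)) (hd (n + 1)) (hm n) (hd n)
    ((hab.row h n).symm.trans (h1 n))
  refine ⟨fun n => ?_, fun n => (key n).2⟩
  cases n with
  | zero =>
    have := mul_right_cancel₀ (hm 0).ne_zero ((h.row_zero).symm.trans h0)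
    exact C_injective (sub_right_injective this)
  | succ n => exact (key n).1

theorem exists_solution_iff (c₀ a₀ d₀ b₀ : ℕ → ℂ) :
    (∃ a b c d : ℕ → ℕ → ℂ, IsSolution a b c d ∧ HasInitialData a b c d c₀ a₀ d₀ b₀ ∧
      NonvanishingInside a b) ↔
    ∃ s₁ s₂ : ℕ → ℂ, IsPerfect s₁ s₂ ∧ DataCorrespond s₁ s₂ c₀ a₀ d₀ b₀ := by
  constructor
  · rintro ⟨a, b, c, d, h, ⟨hc, ha, hd, hb⟩, hn⟩
    obtain ⟨s₁, s₂, P, hp, ht, hN⟩ := h.exists_isPerfect hn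
    refine ⟨s₁, s₂, hp, P, ht, ?_, fun n => ?_, ?_, fun m => ?_⟩
    · rw [← hc]; exact hN.row_zero
    · rw [← hc, ← ha]; exact h.1.row hN n
    · rw [← hd]; exact hN.swap.row_zero
    · rw [← hd, ← hb]; exact h.1.swap.row hN.swap m
  · rintro ⟨s₁, s₂, hp, P, ht, h1, h2, h3, h4⟩
    obtain ⟨a, b, c, d, hab, hN⟩ := hp.exists_nearestNeighbour ht
    obtain ⟨hs, hn⟩ := hp.isSolution ht hab hN
    have hdeg := ht.natDegree_eq hp
    obtain ⟨r1, r2⟩ := hab.row_coefficients hN (fun n => (ht n 0).1) (fun n => hdeg n 0) h1 h2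
    obtain ⟨r3, r4⟩ := hab.swap.row_coefficients hN.swap (fun n => (ht 0 n).1)
      (fun n => (hdeg 0 n).trans (zero_add n)) h3 h4
    exact ⟨a, b, c, d, hs, ⟨r1, r2, r3, r4⟩, hn⟩

end Construction

end HPLax

theorem mainTheorem2 :
    (∀ a b c d : ℕ → ℕ → ℂ, HPLax.ZeroBoundary a b →
      (HPLax.NonzeroDenominators c d →
        ((∃ e : HPLax.LaxEntries, e.HasCoefficients a b c d ∧ e.ZeroCurvature) ↔
          HPLax.DifferenceSystem a b c d)) ∧
      ((∃ e : HPLax.LaxEntries, e.HasCoefficients a b c d ∧ e.Invertible ∧ e.ZeroCurvature) ↔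
        (HPLax.IsSolution a b c d ∧ HPLax.NonvanishingInside a b)) ∧
      ((HPLax.IsSolution a b c d ∧ HPLax.NonvanishingInside a b) ↔
        (∃ (s₁ s₂ : ℕ → ℂ) (P : ℕ → ℕ → Polynomial ℂ), HPLax.IsPerfect s₁ s₂ ∧
          HPLax.IsHermitePadeTable s₁ s₂ P ∧ HPLax.NearestNeighbour P a b c d))) ∧
    (∀ c₀ a₀ d₀ b₀ : ℕ → ℂ,
      (∃ a b c d : ℕ → ℕ → ℂ, HPLax.IsSolution a b c d ∧
          HPLax.HasInitialData a b c d c₀ a₀ d₀ b₀ ∧ HPLax.NonvanishingInside a b) ↔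
        (∃ s₁ s₂ : ℕ → ℂ, HPLax.IsPerfect s₁ s₂ ∧
          HPLax.DataCorrespond s₁ s₂ c₀ a₀ d₀ b₀)) := by
  refine ⟨fun a b c d hab => ⟨HPLax.exists_zeroCurvature_iff,
    HPLax.exists_invertible_zeroCurvature_iff hab, fun ⟨h, hn⟩ => h.exists_isPerfect hn, ?_⟩,
    HPLax.exists_solution_iff⟩
  rintro ⟨s₁, s₂, P, hp, ht, h⟩
  exact hp.isSolution ht hab h
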